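/- All Hilbert spaces are finite-dimensional over $\mathbb{C}$ and $\log$ is to base $2$. For states $\rho,\sigma$ on the same space and $\varepsilon>0$, the smooth hypothesis testing relative entropy $D_H^{\varepsilon}(\rho\|\sigma)$ is defined by $$2^{-D_H^{\varepsilon}(\rho\|\sigma)}=\min\{\operatorname{Tr}[\Pi\sigma] : 0\le \Pi\le \mathbb{I},\ \operatorname{Tr}[\Pi\rho]\ge 1-\varepsilon\}$$ (with value $+\infty$ if the minimum is $0$), and the max relative entropy by $D_{\max}(\rho\|\sigma)=\inf\{\lambda\in\mathbb{R} : \rho\le 2^{\lambda}\sigma\}$. For a bipartite state $\rho^{XY}$ put $$I_H^{\varepsilon}(X:Y)=D_H^{\varepsilon}(\rho^{XY}\|\rho^X\otimes\rho^Y),\qquad I_{\max}(X:Y)=D_{\max}(\rho^{XY}\|\rho^X\otimes\rho^Y).$$ **Theorem.** There are universal constants $c>0$, $c'\in(0,1)$ and $K>0$ such that for every tripartite state $\rho^{A_fB_fC}$ on finite-dimensional Hilbert spaces and every $\varepsilon>0$, $$I_H^{\varepsilon}(A_fB_f:C)\ \ge\ I_H^{c\varepsilon^4}(A_f:C)+I_H^{c\varepsilon^4}(B_f:A_fC)-I_{\max}(A_f:B_f)-\log\!\left(1-c'\varepsilon^{1/4}\right)-K\log\frac1\varepsilon-K,$$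 where all quantities are evaluated on the corresponding marginals of $\rho^{A_fB_fC}$. (For $\varepsilon\ge1$ the left-hand side is $+\infty$ and nothing is claimed.) -/

import Mathlib

open scoped Kronecker ComplexOrder

noncomputable section

namespace QInfo

/-- A quantum state (density operator) on the finite-dimensional Hilbert space `ℂ^X`. -/
structure IsState {X : Type*} [Fintype X] (ρ : Matrix X X ℂ) : Prop where
  posSemidef : ρ.PosSemidef
  trace_eq_one : ρ.trace = 1

/-- The marginal on the first system of an operator on `ℂ^X ⊗ ℂ^Y`
(partial trace over the second system). -/
def margFst {X Y : Type*} [Fintype Y] (ρ : Matrix (X × Y) (X × Y) ℂ) : Matrix X X ℂ :=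
  Matrix.of fun x x' => ∑ y, ρ (x, y) (x', y)

/-- The marginal on the second system of an operator on `ℂ^X ⊗ ℂ^Y`
(partial trace over the first system). -/
def margSnd {X Y : Type*} [Fintype X] (ρ : Matrix (X × Y) (X × Y) ℂ) : Matrix Y Y ℂ :=
  Matrix.of fun y y' => ∑ x, ρ (x, y) (x, y')

/-- The tests allowed in hypothesis testing with error `ε` on `ρ`:
`0 ≤ P ≤ 1` (Loewner order) and `Tr[P ρ] ≥ 1 - ε`. -/
def IsTest {X : Type*} [Fintype X] [DecidableEq X] (ε : ℝ) (ρ P : Matrix X X ℂ) : Prop :=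
  P.PosSemidef ∧ (1 - P).PosSemidef ∧ 1 - ε ≤ (P * ρ).trace.re

/-- The optimal type-II error: the minimum of `Tr[P σ]` over all tests `P` with error at most `ε`
on `ρ`. -/
def typeTwoError {X : Type*} [Fintype X] [DecidableEq X] (ε : ℝ) (ρ σ : Matrix X X ℂ) : ℝ :=
  sInf {t : ℝ | ∃ P : Matrix X X ℂ, IsTest ε ρ P ∧ t = (P * σ).trace.re}

/-- The smooth hypothesis testing relative entropy `D_H^ε(ρ‖σ)`, i.e. `- log₂` of the optimal
type-II error, with value `+∞` if that error is zero. -/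
def hypRelEntropy {X : Type*} [Fintype X] [DecidableEq X] (ε : ℝ) (ρ σ : Matrix X X ℂ) : EReal :=
  if typeTwoError ε ρ σ ≤ 0 then ⊤ else ((-Real.logb 2 (typeTwoError ε ρ σ) : ℝ) : EReal)

/-- The max relative entropy `D_max(ρ‖σ) = inf {l | ρ ≤ 2^l σ}` (Loewner order), with value `+∞`
if there is no such real number `l`. -/
def maxRelEntropy {X : Type*} (ρ σ : Matrix X X ℂ) : EReal :=
  sInf {e : EReal | ∃ l : ℝ, e = (l : EReal) ∧ ((((2 : ℝ) ^ l : ℝ) : ℂ) • σ - ρ).PosSemidef}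

/-- The smooth hypothesis testing mutual information `I_H^ε(X:Y)` in the bipartite state `ρ`. -/
def hypMutualInfo {X Y : Type*} [Fintype X] [Fintype Y] [DecidableEq X] [DecidableEq Y]
    (ε : ℝ) (ρ : Matrix (X × Y) (X × Y) ℂ) : EReal :=
  hypRelEntropy ε ρ (margFst ρ ⊗ₖ margSnd ρ)

/-- The max mutual information `I_max(X:Y)` in the bipartite state `ρ`. -/
def maxMutualInfo {X Y : Type*} [Fintype X] [Fintype Y]
    (ρ : Matrix (X × Y) (X × Y) ℂ) : EReal :=
  maxRelEntropy ρ (margFst ρ ⊗ₖ margSnd ρ)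

/-- A tripartite operator on `A B C`, regarded as a bipartite operator on `AB : C`. -/
def cutABvsC {A B C : Type*} (ρ : Matrix (A × B × C) (A × B × C) ℂ) :
    Matrix ((A × B) × C) ((A × B) × C) ℂ :=
  ρ.submatrix (fun x => (x.1.1, x.1.2, x.2)) (fun x => (x.1.1, x.1.2, x.2))

/-- A tripartite operator on `A B C`, regarded as a bipartite operator on `B : AC`. -/
def cutBvsAC {A B C : Type*} (ρ : Matrix (A × B × C) (A × B × C) ℂ) :
    Matrix (B × (A × C)) (B × (A × C)) ℂ :=
  ρ.submatrix (fun x => (x.2.1, x.1, x.2.2)) (fun x => (x.2.1, x.1, x.2.2))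

/-- The marginal on `AB` of a tripartite operator on `A B C`. -/
def margAB {A B C : Type*} [Fintype C] (ρ : Matrix (A × B × C) (A × B × C) ℂ) :
    Matrix (A × B) (A × B) ℂ :=
  margFst (cutABvsC ρ)

/-- The marginal on `AC` of a tripartite operator on `A B C`. -/
def margAC {A B C : Type*} [Fintype B] (ρ : Matrix (A × B × C) (A × B × C) ℂ) :
    Matrix (A × C) (A × C) ℂ :=
  margSnd (cutBvsAC ρ)

end QInfo

end

/-! The bound is a chain rule proved by composing tests. Take a test `P` for `ρ^{AC}` against `ρ^A ⊗
ρ^C` and a test `Q` for `ρ` against `ρ^B ⊗ ρ^{AC}`. The accepted test is `Gᴴ * Q * G`, where `G = 1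
⊗ F` and `F` acts on `AC`. The contraction `F`, built from `P`, does two things (`exists_filter`):
it nearly fixes `ρ^{AC}`, and it maps `ρ^A ⊗ ρ^C` below a small multiple of `ρ^{AC}`.

The first property keeps the acceptance probability of `Q` on `ρ` almost unchanged
(`trace_filtered_test_ge`). The second turns the error of the new test against `ρ^B ⊗ ρ^A ⊗ ρ^C`
into essentially the product of the errors of `P` and `Q`, up to a factor `1/δ`
(`exists_composed_test`). Finally `ρ^{AB} ≤ 2^l (ρ^A ⊗ ρ^B)` replaces the product by `ρ^{AB} ⊗ ρ^C`
at cost `2^l` (`typeTwoError_chain`); logarithms give the theorem. -/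

open scoped Matrix

namespace QInfo

/-! ### Square roots and traces of positive semidefinite matrices -/

section Sqrt

open scoped MatrixOrder Matrix.Norms.L2Operator

variable {n : Type*} [Fintype n] [DecidableEq n]

/-- Square roots of positive semidefinite matrices, chosen monotonically. -/
lemma exists_sqrt_pair {A B : Matrix n n ℂ} (hA : A.PosSemidef) (hAB : (B - A).PosSemidef) :
    ∃ R Z : Matrix n n ℂ, R.PosSemidef ∧ Z.PosSemidef ∧ R * R = A ∧ Z * Z = B ∧
      (Z - R).PosSemidef := by
  have hB : B.PosSemidef := by simpa using hA.add hAB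
  exact ⟨CFC.sqrt A, CFC.sqrt B, Matrix.nonneg_iff_posSemidef.mp (CFC.sqrt_nonneg A),
    Matrix.nonneg_iff_posSemidef.mp (CFC.sqrt_nonneg B),
    CFC.sqrt_mul_sqrt_self A hA.nonneg, CFC.sqrt_mul_sqrt_self B hB.nonneg,
    CFC.sqrt_le_sqrt A B hAB⟩

end Sqrt

section Trace

variable {n : Type*} [Fintype n]

lemma trace_mul_nonneg {A B : Matrix n n ℂ} (hA : A.PosSemidef) (hB : B.PosSemidef) :
    0 ≤ (A * B).trace.re := by
  classical
  obtain ⟨X, -, hX, -, rfl, -, -⟩ := exists_sqrt_pair hB (B := B)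
    (by simpa using Matrix.PosSemidef.zero)
  have h := hA.mul_mul_conjTranspose_same X
  rw [hX.isHermitian.eq] at h
  rw [← Matrix.mul_assoc, Matrix.trace_mul_comm, ← Matrix.mul_assoc]
  exact (Complex.nonneg_iff.mp h.trace_nonneg).1

lemma trace_mul_le_left {A B D : Matrix n n ℂ} (hAB : (B - A).PosSemidef) (hD : D.PosSemidef) :
    (A * D).trace.re ≤ (B * D).trace.re := by
  have h := trace_mul_nonneg hAB hD
  rw [Matrix.sub_mul, Matrix.trace_sub, Complex.sub_re] at h
  linarith

lemma trace_mul_le_right {A B D : Matrix n n ℂ} (hAB : (B - A).PosSemidef) (hD : D.PosSemidef) :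
    (D * A).trace.re ≤ (D * B).trace.re := by
  rw [Matrix.trace_mul_comm D A, Matrix.trace_mul_comm D B]
  exact trace_mul_le_left hAB hD

lemma trace_conjTranspose_mul_re {F D : Matrix n n ℂ} (hD : D.IsHermitian) :
    (Fᴴ * D).trace.re = (F * D).trace.re := by
  have h : Fᴴ * D = (D * F)ᴴ := by rw [Matrix.conjTranspose_mul, hD.eq]
  rw [h, Matrix.trace_conjTranspose, Matrix.trace_mul_comm D F]
  simp

end Trace

/-! ### The square-root filter -/

section Filter

variable {n : Type*} [Fintype n] [DecidableEq n]

/-- The square-root filter `√ρ (ρ + τ)^{-1/2}` nearly fixes `ρ` if some test separates `ρ` from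
the positive definite operator `τ`. -/
lemma exists_sqrt_filter {ρ τ P : Matrix n n ℂ} {δ θ : ℝ} (hρ : ρ.PosSemidef) (hτ : τ.PosDef)
    (hρ1 : ρ.trace = 1)
    (hP : IsTest δ ρ P) (hPτ : (P * τ).trace.re ≤ θ) :
    ∃ F : Matrix n n ℂ, (1 - Fᴴ * F).PosSemidef ∧ (ρ - F * τ * Fᴴ).PosSemidef ∧
      1 - 2 * δ - θ ≤ (F * ρ).trace.re := by
  obtain ⟨hP0, hP1, hPρ⟩ := hP
  have hτS : ((ρ + τ) - ρ).PosSemidef := by simpa using hτ.posSemidef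
  obtain ⟨R, Z, hR, hZ, hRR, hZZ, hZR⟩ := exists_sqrt_pair hρ hτS
  have hZu : IsUnit Z := by
    have h : IsUnit (Z * Z) := by rw [hZZ]; exact (Matrix.PosDef.posSemidef_add hρ hτ).isUnit
    exact isUnit_of_mul_isUnit_left h
  have hdet := (Matrix.isUnit_iff_isUnit_det Z).mp hZu
  have h1 : Z * Z⁻¹ = 1 := Matrix.mul_nonsing_inv Z hdet
  have h2 : Z⁻¹ * Z = 1 := Matrix.nonsing_inv_mul Z hdet
  have hWp : (Z⁻¹).PosSemidef := hZ.inv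
  generalize Z⁻¹ = W at h1 h2 hWp
  have hWh : Wᴴ = W := hWp.isHermitian.eq
  have hRh : Rᴴ = R := hR.isHermitian.eq
  have hPh : Pᴴ = P := hP0.isHermitian.eq
  have hρh : ρᴴ = ρ := hρ.isHermitian.eq
  have hτe : τ = Z * Z - ρ := by rw [hZZ]; abel
  have e1 : ∀ X, Z * (W * X) = X := fun X => by rw [← Matrix.mul_assoc, h1, Matrix.one_mul]
  have e2 : ∀ X, W * (Z * X) = X := fun X => by rw [← Matrix.mul_assoc, h2, Matrix.one_mul]
  -- With `F = R * W`, one has `1 - Fᴴ * F = W * τ * W` and `ρ - F * τ * Fᴴ = F * ρ * Fᴴ`.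
  refine ⟨R * W, ?_, ?_, ?_⟩
  · have h := hτ.posSemidef.mul_mul_conjTranspose_same W
    convert h using 1
    rw [hWh, hτe, Matrix.conjTranspose_mul, hRh, hWh, ← hRR]
    simp only [Matrix.mul_sub, Matrix.sub_mul, Matrix.mul_assoc, e2, h1]
  · have h := hρ.mul_mul_conjTranspose_same (R * W)
    convert h using 1
    rw [hτe, Matrix.conjTranspose_mul, hRh, hWh]
    simp only [Matrix.mul_sub, Matrix.sub_mul, Matrix.mul_assoc, e2, e1]
    rw [hRR]; abel
  · have hG : (R * W * R).PosSemidef := by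
      simpa [hRh] using hWp.mul_mul_conjTranspose_same R
    -- Operator monotonicity of the square root enters here, through `R ≤ Z`. It bounds `Tr[F ρ]`
    -- below by `Tr[W ρ W ρ]`.
    have hRG : (R - R * W * R).PosSemidef := by
      have a := hR.mul_mul_conjTranspose_same (1 - R * W)
      have b := hZR.mul_mul_conjTranspose_same (R * W)
      convert a.add b using 1
      simp only [Matrix.conjTranspose_sub, Matrix.conjTranspose_one, Matrix.conjTranspose_mul,
        hRh, hWh, Matrix.mul_sub, Matrix.sub_mul, Matrix.mul_assoc, e1, Matrix.one_mul,
        Matrix.mul_one]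
      abel
    have hGG := trace_mul_le_left hRG hG
    have hFρ : (R * W * ρ).trace = (R * (R * W * R)).trace := by
      rw [Matrix.trace_mul_comm R (R * W * R), ← hRR]; simp only [Matrix.mul_assoc]
    have hGG' : (R * W * R * (R * W * R)).trace = (W * ρ * W * ρ).trace := by
      rw [← hRR, Matrix.mul_assoc R W R, Matrix.mul_assoc R, Matrix.trace_mul_comm R]
      simp only [Matrix.mul_assoc]
    have hM : (P - W * ρ * W)ᴴ = P - W * ρ * W := by
      simp only [Matrix.conjTranspose_sub, Matrix.conjTranspose_mul, hPh, hWh, hρh,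
        Matrix.mul_assoc]
    -- The squared norm of `P - W * ρ * W` for the form `Tr[X Z Y Z]`; its cross term is `Tr[P ρ]`.
    -- As `Tr[Z P Z P] ≤ Tr[P (ρ + τ)]`, this gives `Tr[W ρ W ρ] ≥ Tr[P ρ] - Tr[P τ]`.
    have hsq := trace_mul_nonneg (hZ.mul_mul_conjTranspose_same (P - W * ρ * W)) hZ
    rw [hM] at hsq
    have hexp : ((P - W * ρ * W) * Z * (P - W * ρ * W) * Z).trace
        = (Z * P * Z * P).trace - 2 * (P * ρ).trace + (W * ρ * W * ρ).trace := by
      have t1 : (P * (Z * (P * Z))).trace = (Z * (P * (Z * P))).trace := by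
        rw [Matrix.trace_mul_comm]; simp only [Matrix.mul_assoc]
      have t2 : (W * (ρ * (P * Z))).trace = (P * ρ).trace := by
        rw [Matrix.trace_mul_comm]; simp only [Matrix.mul_assoc, h1, Matrix.mul_one]
        exact Matrix.trace_mul_comm _ _
      simp only [Matrix.mul_sub, Matrix.sub_mul, Matrix.mul_assoc, e1, h2, Matrix.mul_one,
        Matrix.trace_sub, t1, t2]
      ring
    have hZPZ : (Z * P * Z).PosSemidef := by
      have h := hP0.mul_mul_conjTranspose_same Z
      rwa [hZ.isHermitian.eq] at h
    have hPS := trace_mul_le_right hP1 hZPZ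
    have hPS' : (Z * P * Z * 1).trace = (P * ρ).trace + (P * τ).trace := by
      rw [Matrix.mul_one, Matrix.mul_assoc, Matrix.trace_mul_comm, Matrix.mul_assoc, hZZ,
        Matrix.mul_add, Matrix.trace_add]
    -- Needed only to force `0 ≤ δ`.
    have hPρ1 := trace_mul_le_left hP1 hρ
    rw [Matrix.one_mul, hρ1, Complex.one_re] at hPρ1
    rw [hexp] at hsq
    rw [hPS', Complex.add_re] at hPS
    rw [← hFρ, hGG'] at hGG
    simp only [Complex.add_re, Complex.sub_re, Complex.mul_re, Complex.re_ofNat, Complex.im_ofNat]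
      at hsq
    linarith

/-- A test of error `δ` against `σ` yields a contraction that nearly fixes `ρ` and maps `σ` below a
small multiple of `ρ`. -/
lemma exists_filter {ρ σ P : Matrix n n ℂ} {δ u : ℝ} (hρ : IsState ρ) (hσ : σ.PosSemidef)
    (hδ : 0 < δ) (hu : 0 < u) (hP : IsTest δ ρ P) (hPσ : (P * σ).trace.re ≤ u) :
    ∃ F : Matrix n n ℂ, (1 - Fᴴ * F).PosSemidef ∧
      (((u / δ : ℝ) : ℂ) • ρ - F * σ * Fᴴ).PosSemidef ∧ 1 - 4 * δ ≤ (F * ρ).trace.re := by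
  set d : ℝ := P.trace.re with hd
  -- Take `τ = κ σ + η 1`: the `η` term makes `τ` invertible even if `σ` is singular, and `κ`, `η`
  -- are scaled so that each term adds at most `δ` to `Tr[P τ]`.
  have hd0 : 0 ≤ d := (Complex.nonneg_iff.mp hP.1.trace_nonneg).1
  set η : ℝ := δ / (d + 1) with hη
  have hη0 : 0 < η := by positivity
  set κ : ℝ := δ / u with hκ
  have hκ0 : 0 < κ := by positivity
  have hκσ : ((κ : ℂ) • σ).PosSemidef := hσ.smul (by exact_mod_cast hκ0.le)
  have hη1 : ((η : ℂ) • (1 : Matrix n n ℂ)).PosDef :=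
    Matrix.PosDef.one.smul (by exact_mod_cast hη0)
  have hτ := Matrix.PosDef.posSemidef_add hκσ hη1
  have hθ : (P * ((κ : ℂ) • σ + (η : ℂ) • 1)).trace.re ≤ 2 * δ := by
    simp only [Matrix.mul_add, Matrix.mul_smul, Matrix.mul_one, Matrix.trace_add,
      Matrix.trace_smul, smul_eq_mul, Complex.add_re, Complex.re_ofReal_mul]
    rw [← hd]
    have a : κ * (P * σ).trace.re ≤ κ * u := by gcongr
    have b : κ * u = δ := by rw [hκ]; field_simp
    have c : η * d ≤ δ := by
      rw [hη, div_mul_eq_mul_div, div_le_iff₀ (by positivity)]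
      nlinarith
    linarith
  obtain ⟨F, hF1, hF2, hF3⟩ := exists_sqrt_filter hρ.posSemidef hτ hρ.trace_eq_one hP hθ
  refine ⟨F, hF1, ?_, by linarith⟩
  have hs : ((κ⁻¹ : ℝ) : ℂ) • (ρ - F * ((κ : ℂ) • σ) * Fᴴ) =
      ((u / δ : ℝ) : ℂ) • ρ - F * σ * Fᴴ := by
    have h : κ⁻¹ = u / δ := by rw [hκ, inv_div]
    rw [smul_sub, Matrix.mul_smul, Matrix.smul_mul, smul_smul, ← Complex.ofReal_mul,
      inv_mul_cancel₀ hκ0.ne', Complex.ofReal_one, one_smul, h]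
  rw [← hs]
  refine Matrix.PosSemidef.smul ?_ (by exact_mod_cast (inv_pos.mpr hκ0).le)
  have h := hF2.add (hη1.posSemidef.mul_mul_conjTranspose_same F)
  convert h using 1
  rw [Matrix.mul_add, Matrix.add_mul]
  abel

/-- Filtering with a contraction that nearly fixes `ρ` hardly changes the acceptance probability
of a test. -/
lemma trace_filtered_test_ge {ρ F Q : Matrix n n ℂ} {δ δ' t : ℝ} (hρ : IsState ρ) (ht : 0 < t)
    (hF : (1 - Fᴴ * F).PosSemidef) (hFρ : 1 - δ' ≤ (F * ρ).trace.re) (hQ : IsTest δ ρ Q) :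
    1 - δ - (1 + 1 / t) * (2 * δ') ≤ (1 + t) * (Fᴴ * Q * F * ρ).trace.re := by
  obtain ⟨hQ0, hQ1, hQρ⟩ := hQ
  have hone : (1 * ρ).trace.re = 1 := by rw [Matrix.one_mul, hρ.trace_eq_one, Complex.one_re]
  have hFF := trace_mul_le_left hF hρ.posSemidef
  have hFh := trace_conjTranspose_mul_re (F := F) hρ.posSemidef.isHermitian
  have hQY : (((1 - F)ᴴ * (1 - F)) - (1 - F)ᴴ * Q * (1 - F)).PosSemidef := by
    convert hQ1.conjTranspose_mul_mul_same (1 - F) using 1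
    rw [Matrix.mul_sub (1 - F)ᴴ 1 Q, Matrix.sub_mul, Matrix.mul_one]
  have hY := trace_mul_le_left hQY hρ.posSemidef
  -- Weighted Cauchy–Schwarz for the splitting `1 = F + (1 - F)`: positivity at `t F - (1 - F)`
  -- controls the cross terms.
  have hX := trace_mul_nonneg (hQ0.conjTranspose_mul_mul_same ((t : ℂ) • F - (1 - F)))
    hρ.posSemidef
  set a := (Fᴴ * Q * F * ρ).trace.re with ha
  set y := ((1 - F)ᴴ * Q * (1 - F) * ρ).trace.re with hy
  have hy8 : y ≤ 2 * δ' := by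
    have e : (1 - F)ᴴ * (1 - F) * ρ = 1 * ρ - F * ρ - Fᴴ * ρ + Fᴴ * F * ρ := by
      simp only [Matrix.conjTranspose_sub, Matrix.conjTranspose_one, Matrix.sub_mul,
        Matrix.mul_sub, Matrix.one_mul, Matrix.mul_one]
      abel
    rw [e] at hY
    simp only [Matrix.trace_add, Matrix.trace_sub, Complex.add_re, Complex.sub_re] at hY
    linarith
  have hexp : (((t : ℂ) • F - (1 - F))ᴴ * Q * ((t : ℂ) • F - (1 - F)) * ρ).trace.re =
      (t ^ 2 + t) * a + (1 + t) * y - t * (Q * ρ).trace.re := by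
    have e : ((t : ℂ) • F - (1 - F))ᴴ * Q * ((t : ℂ) • F - (1 - F)) * ρ =
        ((t ^ 2 + t : ℝ) : ℂ) • (Fᴴ * Q * F * ρ) +
          ((1 + t : ℝ) : ℂ) • ((1 - F)ᴴ * Q * (1 - F) * ρ) - (t : ℂ) • (Q * ρ) := by
      simp only [Matrix.conjTranspose_sub, Matrix.conjTranspose_one, Matrix.conjTranspose_smul,
        Matrix.sub_mul, Matrix.mul_sub, Matrix.one_mul, Matrix.mul_one, Matrix.smul_mul,
        Matrix.mul_smul, Complex.star_def, Complex.conj_ofReal, Complex.ofReal_add,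
        Complex.ofReal_pow, Complex.ofReal_one]
      module
    rw [e]
    simp only [Matrix.trace_add, Matrix.trace_sub, Matrix.trace_smul, smul_eq_mul, Complex.add_re,
      Complex.sub_re, Complex.re_ofReal_mul, ← ha, ← hy]
  rw [hexp] at hX
  have hX' : (Q * ρ).trace.re ≤ (1 + t) * a + (1 + 1 / t) * y := by
    have h : t * (Q * ρ).trace.re ≤ t * ((1 + t) * a + (1 + 1 / t) * y) := by
      have h' : t * ((1 + t) * a + (1 + 1 / t) * y) = (t ^ 2 + t) * a + (1 + t) * y := by
        field_simp
        ring
      rw [h']; linarith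
    exact le_of_mul_le_mul_left h ht
  have hyt : (1 + 1 / t) * y ≤ (1 + 1 / t) * (2 * δ') := by gcongr
  linarith

end Filter

/-! ### Tensor products, marginals and relabelling -/

section Kronecker

variable {X Y : Type*}

lemma kronecker_sub (M : Matrix X X ℂ) (N N' : Matrix Y Y ℂ) :
    M ⊗ₖ (N - N') = M ⊗ₖ N - M ⊗ₖ N' := by
  ext i j
  exact mul_sub _ _ _

lemma sub_kronecker (M M' : Matrix X X ℂ) (N : Matrix Y Y ℂ) :
    (M - M') ⊗ₖ N = M ⊗ₖ N - M' ⊗ₖ N := by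
  ext i j
  exact sub_mul _ _ _

end Kronecker

section Marginals

variable {X Y : Type*}

lemma margFst_posSemidef [Fintype Y] {ρ : Matrix (X × Y) (X × Y) ℂ} (h : ρ.PosSemidef) :
    (margFst ρ).PosSemidef := by
  have e : margFst ρ = ∑ y, ρ.submatrix (fun x => (x, y)) (fun x => (x, y)) := by
    ext i j
    simp [margFst, Matrix.sum_apply]
  rw [e]
  exact Matrix.posSemidef_sum _ fun y _ => h.submatrix _

lemma margSnd_posSemidef [Fintype X] {ρ : Matrix (X × Y) (X × Y) ℂ} (h : ρ.PosSemidef) :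
    (margSnd ρ).PosSemidef := by
  have e : margSnd ρ = ∑ x, ρ.submatrix (fun y => (x, y)) (fun y => (x, y)) := by
    ext i j
    simp [margSnd, Matrix.sum_apply]
  rw [e]
  exact Matrix.posSemidef_sum _ fun y _ => h.submatrix _

variable [Fintype X] [Fintype Y]

lemma trace_one_kronecker_mul [DecidableEq X] (F : Matrix Y Y ℂ) (ρ : Matrix (X × Y) (X × Y) ℂ) :
    (((1 : Matrix X X ℂ) ⊗ₖ F) * ρ).trace = (F * margSnd ρ).trace := by
  simp only [Matrix.trace, Matrix.diag, Matrix.mul_apply, margSnd, Matrix.of_apply,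
    Matrix.kroneckerMap_apply, Fintype.sum_prod_type, Matrix.one_apply, ite_mul, one_mul, zero_mul,
    Finset.sum_ite_irrel, Finset.sum_const_zero, Finset.sum_ite_eq, Finset.mem_univ, if_true,
    Finset.mul_sum]
  rw [Finset.sum_comm]
  exact Finset.sum_congr rfl fun _ _ => Finset.sum_comm

lemma trace_margSnd (ρ : Matrix (X × Y) (X × Y) ℂ) : (margSnd ρ).trace = ρ.trace := by
  classical
  simpa using (trace_one_kronecker_mul (1 : Matrix Y Y ℂ) ρ).symm

lemma IsState.margSnd {ρ : Matrix (X × Y) (X × Y) ℂ} (h : IsState ρ) : IsState (margSnd ρ) :=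
  ⟨margSnd_posSemidef h.posSemidef, by rw [trace_margSnd, h.trace_eq_one]⟩

end Marginals

section Submatrix

variable {m n : Type*} [Fintype m] [Fintype n]

lemma trace_submatrix_equiv (e : m ≃ n) (M : Matrix n n ℂ) : (M.submatrix e e).trace = M.trace :=
  Equiv.sum_comp e fun i => M i i

lemma IsState.submatrix {ρ : Matrix n n ℂ} (h : IsState ρ) (e : m ≃ n) :
    IsState (ρ.submatrix e e) :=
  ⟨h.posSemidef.submatrix _, by rw [trace_submatrix_equiv, h.trace_eq_one]⟩

lemma IsTest.submatrix [DecidableEq m] [DecidableEq n] {ρ P : Matrix n n ℂ} {ε : ℝ}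
    (h : IsTest ε ρ P) (e : m ≃ n) : IsTest ε (ρ.submatrix e e) (P.submatrix e e) := by
  refine ⟨h.1.submatrix _, ?_, ?_⟩
  · simpa [Matrix.submatrix_sub] using h.2.1.submatrix e
  · rw [Matrix.submatrix_mul_equiv, trace_submatrix_equiv]
    exact h.2.2

end Submatrix

/-! ### Elementary properties of the type-II error -/

section TypeTwoError

variable {n : Type*} [Fintype n] [DecidableEq n]

lemma typeTwoError_le {ρ σ P : Matrix n n ℂ} {ε : ℝ} (hσ : σ.PosSemidef) (hP : IsTest ε ρ P) :
    typeTwoError ε ρ σ ≤ (P * σ).trace.re := by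
  refine csInf_le ⟨0, ?_⟩ ⟨P, hP, rfl⟩
  rintro _ ⟨P', hP', rfl⟩
  exact trace_mul_nonneg hP'.1 hσ

lemma typeTwoError_nonneg {ρ σ : Matrix n n ℂ} {ε : ℝ} (hσ : σ.PosSemidef) :
    0 ≤ typeTwoError ε ρ σ := by
  refine Real.sInf_nonneg ?_
  rintro _ ⟨P', hP', rfl⟩
  exact trace_mul_nonneg hP'.1 hσ

lemma isTest_one {ρ : Matrix n n ℂ} {ε : ℝ} (hρ : IsState ρ) (hε : 0 ≤ ε) : IsTest ε ρ 1 :=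
  ⟨Matrix.PosSemidef.one, by simpa using Matrix.PosSemidef.zero, by
    rw [Matrix.one_mul, hρ.trace_eq_one, Complex.one_re]; linarith⟩

lemma isTest_zero {ρ : Matrix n n ℂ} {ε : ℝ} (hε : 1 ≤ ε) : IsTest ε ρ 0 :=
  ⟨Matrix.PosSemidef.zero, by simpa using Matrix.PosSemidef.one, by simpa using hε⟩

lemma le_typeTwoError {ρ σ : Matrix n n ℂ} {ε r : ℝ} (hρ : IsState ρ) (hε : 0 ≤ ε)
    (h : ∀ P, IsTest ε ρ P → r ≤ (P * σ).trace.re) : r ≤ typeTwoError ε ρ σ := by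
  refine le_csInf ⟨_, 1, isTest_one hρ hε, rfl⟩ ?_
  rintro _ ⟨P, hP, rfl⟩
  exact h P hP

lemma hypRelEntropy_eq_top {ρ σ : Matrix n n ℂ} {ε : ℝ} (h : typeTwoError ε ρ σ ≤ 0) :
    hypRelEntropy ε ρ σ = ⊤ := if_pos h

lemma hypRelEntropy_eq_coe {ρ σ : Matrix n n ℂ} {ε : ℝ} (h : 0 < typeTwoError ε ρ σ) :
    hypRelEntropy ε ρ σ = ((-Real.logb 2 (typeTwoError ε ρ σ) : ℝ) : EReal) :=
  if_neg (not_le.mpr h)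

end TypeTwoError

/-! ### Composition of tests and the chain rule -/

section ChainRule

/-- Tests for the two steps `ρ` versus `ρ^X ⊗ ρ^Y` and `ρ^Y` versus `σ` compose to a test for `ρ`
versus `ρ^X ⊗ σ`. -/
lemma exists_composed_test {X Y : Type*} [Fintype X] [Fintype Y] [DecidableEq X] [DecidableEq Y]
    {ρ Q : Matrix (X × Y) (X × Y) ℂ} {σ P : Matrix Y Y ℂ} {ε u : ℝ} (hρ : IsState ρ)
    (hσ : σ.PosSemidef) (hε : 0 < ε) (hε1 : ε < 1) (hu : 0 < u)
    (hP : IsTest (1 / 100 * ε ^ 4) (margSnd ρ) P) (hPσ : (P * σ).trace.re ≤ u)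
    (hQ : IsTest (1 / 100 * ε ^ 4) ρ Q) :
    ∃ T, IsTest ε ρ T ∧ (T * (margFst ρ ⊗ₖ σ)).trace.re ≤
      u / (1 / 100 * ε ^ 4) * (Q * (margFst ρ ⊗ₖ margSnd ρ)).trace.re := by
  set δ : ℝ := 1 / 100 * ε ^ 4 with hδ
  have hδ0 : 0 < δ := by positivity
  obtain ⟨F, hF1, hF2, hF3⟩ := exists_filter hρ.margSnd hσ hδ0 hu hP hPσ
  set G : Matrix (X × Y) (X × Y) ℂ := 1 ⊗ₖ F with hG
  have hG1 : (1 - Gᴴ * G).PosSemidef := by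
    have e : 1 - Gᴴ * G = (1 : Matrix X X ℂ) ⊗ₖ (1 - Fᴴ * F) := by
      rw [hG, Matrix.conjTranspose_kronecker, ← Matrix.mul_kronecker_mul, kronecker_sub,
        Matrix.one_kronecker_one]
      simp
    rw [e]
    exact Matrix.PosSemidef.one.kronecker hF1
  have hG3 : 1 - 4 * δ ≤ (G * ρ).trace.re := by rwa [hG, trace_one_kronecker_mul]
  -- The weight `t = ε / 2` balances the losses: both the factor `1 + t` and the term `8 δ / t` stay
  -- of order `ε`, which only needs `δ ≤ ε ^ 2 / 100`.
  have hge := trace_filtered_test_ge (t := ε / 2) hρ (by positivity) hG1 hG3 hQ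
  refine ⟨Gᴴ * Q * G, ⟨hQ.1.conjTranspose_mul_mul_same G, ?_, ?_⟩, ?_⟩
  · convert hG1.add (hQ.2.1.conjTranspose_mul_mul_same G) using 1
    rw [Matrix.mul_sub, Matrix.sub_mul, Matrix.mul_one]
    abel
  · set v := (Gᴴ * Q * G * ρ).trace.re
    have hδε : δ ≤ ε ^ 2 / 100 := by
      rw [hδ]
      nlinarith [pow_le_one₀ hε.le hε1.le (n := 2), sq_nonneg ε]
    have h2 : 1 / (ε / 2) * (2 * (4 * δ)) ≤ 16 / 100 * ε := by
      rw [one_div_mul_eq_div, div_le_iff₀ (by positivity)]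
      nlinarith
    have h3 : (1 + ε / 2) * (1 - ε) ≤ (1 + ε / 2) * v := by nlinarith
    exact le_of_mul_le_mul_left h3 (by positivity)
  · have hle : (((u / δ : ℝ) : ℂ) • (margFst ρ ⊗ₖ margSnd ρ) -
        G * (margFst ρ ⊗ₖ σ) * Gᴴ).PosSemidef := by
      have e : ((u / δ : ℝ) : ℂ) • (margFst ρ ⊗ₖ margSnd ρ) - G * (margFst ρ ⊗ₖ σ) * Gᴴ =
          margFst ρ ⊗ₖ (((u / δ : ℝ) : ℂ) • margSnd ρ - F * σ * Fᴴ) := by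
        rw [hG, Matrix.conjTranspose_kronecker, ← Matrix.mul_kronecker_mul,
          ← Matrix.mul_kronecker_mul, kronecker_sub, Matrix.kronecker_smul]
        simp
      rw [e]
      exact (margFst_posSemidef hρ.posSemidef).kronecker hF2
    have h := trace_mul_le_right hle hQ.1
    rw [Matrix.mul_smul, Matrix.trace_smul, smul_eq_mul, Complex.re_ofReal_mul] at h
    refine le_trans (le_of_eq ?_) h
    congr 1
    rw [Matrix.mul_assoc, Matrix.mul_assoc, Matrix.trace_mul_comm]
    simp only [Matrix.mul_assoc]

variable {A B C : Type*}

/-- The regrouping of `AB : C` as `B : AC`. -/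
def regroup (A B C : Type*) : (A × B) × C ≃ B × (A × C) where
  toFun x := (x.1.2, x.1.1, x.2)
  invFun x := ((x.2.1, x.1), x.2.2)
  left_inv _ := rfl
  right_inv _ := rfl

variable [Fintype A] [Fintype B] [Fintype C]

lemma isState_cutBvsAC {ρ : Matrix (A × B × C) (A × B × C) ℂ} (hρ : IsState ρ) :
    IsState (cutBvsAC ρ) :=
  hρ.submatrix (m := B × (A × C))
    ⟨fun x => (x.2.1, x.1, x.2.2), fun x => (x.2.1, x.1, x.2.2), fun _ => rfl, fun _ => rfl⟩

lemma product_marginals_eq_submatrix (ρ : Matrix (A × B × C) (A × B × C) ℂ) :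
    (margFst (margAB ρ) ⊗ₖ margSnd (margAB ρ)) ⊗ₖ margSnd (cutABvsC ρ) =
      (margFst (cutBvsAC ρ) ⊗ₖ (margFst (margAC ρ) ⊗ₖ margSnd (margAC ρ))).submatrix
        (regroup A B C) (regroup A B C) := by
  have hA : margFst (margAB ρ) = margFst (margAC ρ) := by
    ext i j
    exact Finset.sum_comm
  have hB : margSnd (margAB ρ) = margFst (cutBvsAC ρ) := by
    ext i j
    simp [margSnd, margAB, margFst, cutABvsC, cutBvsAC, Fintype.sum_prod_type]
  have hC : margSnd (cutABvsC ρ) = margSnd (margAC ρ) := by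
    ext i j
    simp [margSnd, margAC, cutABvsC, cutBvsAC, Fintype.sum_prod_type]
  rw [hA, hB, hC]
  ext ⟨⟨a, b⟩, c⟩ ⟨⟨a', b'⟩, c'⟩
  simp only [Matrix.kroneckerMap_apply, Matrix.submatrix_apply, regroup, Equiv.coe_fn_mk]
  ring

variable [DecidableEq A] [DecidableEq B] [DecidableEq C]

/-- Composition is applied with `X = B`, `Y = AC` and `σ = ρ^A ⊗ ρ^C`. The infima need not be
attained for the argument. -/
lemma typeTwoError_chain {ρ : Matrix (A × B × C) (A × B × C) ℂ} (hρ : IsState ρ) {ε l : ℝ}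
    (hε : 0 < ε) (hε1 : ε < 1)
    (hl : ((((2 : ℝ) ^ l : ℝ) : ℂ) • (margFst (margAB ρ) ⊗ₖ margSnd (margAB ρ)) -
      margAB ρ).PosSemidef) :
    typeTwoError ε (cutABvsC ρ) (margFst (cutABvsC ρ) ⊗ₖ margSnd (cutABvsC ρ)) ≤
      2 ^ l / (1 / 100 * ε ^ 4) *
        (typeTwoError (1 / 100 * ε ^ 4) (margAC ρ) (margFst (margAC ρ) ⊗ₖ margSnd (margAC ρ)) *
        typeTwoError (1 / 100 * ε ^ 4) (cutBvsAC ρ)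
          (margFst (cutBvsAC ρ) ⊗ₖ margSnd (cutBvsAC ρ))) := by
  have hD := isState_cutBvsAC hρ
  have hAC : IsState (margAC ρ) := hD.margSnd
  have hABC : IsState (cutABvsC ρ) := hD.submatrix (regroup A B C)
  have hAB := margFst_posSemidef hABC.posSemidef
  have hCp := margSnd_posSemidef hABC.posSemidef
  have hσ := (margFst_posSemidef hAC.posSemidef).kronecker (margSnd_posSemidef hAC.posSemidef)
  have hσB := (margFst_posSemidef hD.posSemidef).kronecker (margSnd_posSemidef hD.posSemidef)
  have hδ0 : 0 < 1 / 100 * ε ^ 4 := by positivity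
  set β := typeTwoError ε (cutABvsC ρ) (margFst (cutABvsC ρ) ⊗ₖ margSnd (cutABvsC ρ))
  set M : ℝ := 2 ^ l / (1 / 100 * ε ^ 4) with hM
  have hM0 : 0 < M := by positivity
  have key : ∀ P Q u, IsTest (1 / 100 * ε ^ 4) (margAC ρ) P →
      IsTest (1 / 100 * ε ^ 4) (cutBvsAC ρ) Q → 0 < u →
      (P * (margFst (margAC ρ) ⊗ₖ margSnd (margAC ρ))).trace.re ≤ u →
      β ≤ M * (u * (Q * (margFst (cutBvsAC ρ) ⊗ₖ margSnd (cutBvsAC ρ))).trace.re) := by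
    intro P Q u hP hQ hu hPu
    obtain ⟨T, hT, hTle⟩ := exists_composed_test hD hσ hε hε1 hu hP hPu hQ
    have hT' := hT.submatrix (regroup A B C)
    have h1 := typeTwoError_le (hAB.kronecker hCp) hT'
    have hdom := hl.kronecker hCp
    rw [sub_kronecker, Matrix.smul_kronecker, product_marginals_eq_submatrix] at hdom
    have h2 := trace_mul_le_right hdom hT'.1
    rw [Matrix.mul_smul, Matrix.trace_smul, smul_eq_mul, Complex.re_ofReal_mul,
      Matrix.submatrix_mul_equiv, trace_submatrix_equiv] at h2
    calc β ≤ _ := h1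
      _ ≤ _ := h2
      _ ≤ _ := mul_le_mul_of_nonneg_left hTle (by positivity)
      _ = _ := by rw [hM]; ring
  have hstep : ∀ Q u, IsTest (1 / 100 * ε ^ 4) (cutBvsAC ρ) Q → 0 < u →
      typeTwoError (1 / 100 * ε ^ 4) (margAC ρ)
        (margFst (margAC ρ) ⊗ₖ margSnd (margAC ρ)) < u →
      β ≤ M * (u * (Q * (margFst (cutBvsAC ρ) ⊗ₖ margSnd (cutBvsAC ρ))).trace.re) := by
    intro Q u hQ hu hlt
    obtain ⟨_, ⟨P, hP, rfl⟩, hPu⟩ := exists_lt_of_csInf_lt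
      (s := {t : ℝ | ∃ P, IsTest (1 / 100 * ε ^ 4) (margAC ρ) P ∧
        t = (P * (margFst (margAC ρ) ⊗ₖ margSnd (margAC ρ))).trace.re})
      ⟨_, 1, isTest_one hAC hδ0.le, rfl⟩ hlt
    exact key P Q u hP hQ hu hPu.le
  set β₁ := typeTwoError (1 / 100 * ε ^ 4) (margAC ρ) (margFst (margAC ρ) ⊗ₖ margSnd (margAC ρ))
  have hβ₁ : 0 ≤ β₁ := typeTwoError_nonneg hσ
  have hu : ∀ u, β₁ < u → β ≤ M * (u * typeTwoError (1 / 100 * ε ^ 4) (cutBvsAC ρ)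
          (margFst (cutBvsAC ρ) ⊗ₖ margSnd (cutBvsAC ρ))) := by
    intro u hlt
    have hu0 : 0 < u := hβ₁.trans_lt hlt
    have : β / (M * u) ≤ typeTwoError (1 / 100 * ε ^ 4) (cutBvsAC ρ)
          (margFst (cutBvsAC ρ) ⊗ₖ margSnd (cutBvsAC ρ)) := by
      refine le_typeTwoError hD hδ0.le fun Q hQ => ?_
      rw [div_le_iff₀ (by positivity)]
      linarith [hstep Q u hQ hu0 hlt]
    rw [div_le_iff₀ (by positivity)] at this
    linarith
  -- The filter needs `u > 0` while `β₁` may vanish, so the bound is proved for every `u > β₁` and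
  -- passes to the limit `u → β₁`.
  refine ge_of_tendsto (x := nhdsWithin β₁ (Set.Ioi β₁)) (f := fun u => M * (u * _)) ?_
    (Filter.eventually_of_mem self_mem_nhdsWithin hu)
  refine Filter.Tendsto.mono_left (Continuous.tendsto (by fun_prop) β₁) nhdsWithin_le_nhds

end ChainRule

end QInfo

theorem theorem2 :
    ∃ c c' K : ℝ, 0 < c ∧ 0 < c' ∧ c' < 1 ∧ 0 < K ∧
      ∀ (A B C : Type*) [Fintype A] [Fintype B] [Fintype C]
        [DecidableEq A] [DecidableEq B] [DecidableEq C]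
        (ρ : Matrix (A × B × C) (A × B × C) ℂ), QInfo.IsState ρ →
        ∀ ε : ℝ, 0 < ε →
          QInfo.hypMutualInfo ε (QInfo.cutABvsC ρ) ≥
            QInfo.hypMutualInfo (c * ε ^ 4) (QInfo.margAC ρ)
              + QInfo.hypMutualInfo (c * ε ^ 4) (QInfo.cutBvsAC ρ)
              - QInfo.maxMutualInfo (QInfo.margAB ρ)
              - ((Real.logb 2 (1 - c' * ε ^ (1 / 4 : ℝ)) : ℝ) : EReal)
              - ((K * Real.logb 2 (1 / ε) : ℝ) : EReal)
              - ((K : ℝ) : EReal) := by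
  open QInfo in
  -- `K = 8` absorbs `log 100 ≤ 7` and `-log(1 - ε^{1/4}/2) ≤ 1`; its multiple of `log(1/ε)` also
  -- covers the `4 log(1/ε)` coming from `ε ^ 4`.
  refine ⟨1 / 100, 1 / 2, 8, by norm_num, by norm_num, by norm_num, by norm_num, ?_⟩
  intro A B C _ _ _ _ _ _ ρ hρ ε hε
  have hD := isState_cutBvsAC hρ
  have hAC : IsState (margAC ρ) := hD.margSnd
  have hABC : IsState (cutABvsC ρ) := hD.submatrix (regroup A B C)
  have hσ := (margFst_posSemidef hAC.posSemidef).kronecker (margSnd_posSemidef hAC.posSemidef)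
  have hσB := (margFst_posSemidef hD.posSemidef).kronecker (margSnd_posSemidef hD.posSemidef)
  have hσC := (margFst_posSemidef hABC.posSemidef).kronecker (margSnd_posSemidef hABC.posSemidef)
  unfold hypMutualInfo
  set β := typeTwoError ε (cutABvsC ρ) (margFst (cutABvsC ρ) ⊗ₖ margSnd (cutABvsC ρ)) with hβ
  rcases le_or_gt β 0 with hβ0 | hβ0
  · rw [hypRelEntropy_eq_top hβ0]; exact le_top
  have hε1 : ε < 1 := by
    by_contra! h
    have := typeTwoError_le hσC (isTest_zero (ρ := cutABvsC ρ) h)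
    simp only [Matrix.zero_mul, Matrix.trace_zero, Complex.zero_re] at this
    exact absurd hβ0 (not_lt.mpr this)
  rw [hypRelEntropy_eq_coe hβ0, ← hβ]
  by_cases hex : ∃ l : ℝ, ((((2 : ℝ) ^ l : ℝ) : ℂ) •
      (margFst (margAB ρ) ⊗ₖ margSnd (margAB ρ)) - margAB ρ).PosSemidef
  swap
  -- Subtracting `⊤` in `EReal` gives `⊥`, even from `⊤`, so the claim is trivial in this case.
  · have htop : maxMutualInfo (margAB ρ) = ⊤ := by
      refine sInf_eq_top.mpr ?_
      rintro _ ⟨l, -, hl⟩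
      exact absurd ⟨l, hl⟩ hex
    rw [htop]
    simp
  set β₁ := typeTwoError (1 / 100 * ε ^ 4) (margAC ρ)
    (margFst (margAC ρ) ⊗ₖ margSnd (margAC ρ)) with hβ₁
  set β₂ := typeTwoError (1 / 100 * ε ^ 4) (cutBvsAC ρ)
    (margFst (cutBvsAC ρ) ⊗ₖ margSnd (cutBvsAC ρ)) with hβ₂
  have hchain : ∀ l : ℝ, ((((2 : ℝ) ^ l : ℝ) : ℂ) •
      (margFst (margAB ρ) ⊗ₖ margSnd (margAB ρ)) - margAB ρ).PosSemidef →
      β ≤ 2 ^ l / (1 / 100 * ε ^ 4) * (β₁ * β₂) := fun l hl => typeTwoError_chain hρ hε hε1 hl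
  have h₁ : 0 ≤ β₁ := typeTwoError_nonneg hσ
  have h₂ : 0 ≤ β₂ := typeTwoError_nonneg hσB
  -- By the chain bound, `β > 0` excludes infinite values on the right, so the rest is real
  -- arithmetic.
  have hpos : 0 < β₁ * β₂ := by
    obtain ⟨l, hl⟩ := hex
    have := hβ0.trans_le (hchain l hl)
    exact pos_of_mul_pos_right this (by positivity)
  have hβ₁0 : 0 < β₁ := pos_of_mul_pos_left hpos h₂
  have hβ₂0 : 0 < β₂ := pos_of_mul_pos_right hpos h₁
  rw [hypRelEntropy_eq_coe hβ₁0, hypRelEntropy_eq_coe hβ₂0, ← hβ₁, ← hβ₂]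
  set m := Real.logb 2 β - Real.logb 2 β₁ - Real.logb 2 β₂ + Real.logb 2 (1 / 100 * ε ^ 4) with hm
  have hmle : (m : EReal) ≤ maxMutualInfo (margAB ρ) := by
    refine le_sInf ?_
    rintro _ ⟨l, rfl, hl⟩
    have h := Real.logb_le_logb_of_le (b := 2) (by norm_num) hβ0 (hchain l hl)
    rw [Real.logb_mul (by positivity) (by positivity), Real.logb_div (by positivity)
      (by positivity), Real.logb_rpow (by norm_num) (by norm_num),
      Real.logb_mul hβ₁0.ne' hβ₂0.ne'] at h
    exact EReal.coe_le_coe_iff.mpr (by linarith)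
  have hreal : -Real.logb 2 β₁ + -Real.logb 2 β₂ - m
      - Real.logb 2 (1 - 1 / 2 * ε ^ (1 / 4 : ℝ)) - 8 * Real.logb 2 (1 / ε) - 8 ≤
      -Real.logb 2 β := by
    have hε4 : ε ^ (1 / 4 : ℝ) ≤ 1 := Real.rpow_le_one hε.le hε1.le (by norm_num)
    have ha : Real.logb 2 (1 / 2) ≤ Real.logb 2 (1 - 1 / 2 * ε ^ (1 / 4 : ℝ)) :=
      Real.logb_le_logb_of_le (by norm_num) (by norm_num) (by linarith)
    have hb : Real.logb 2 (1 / 2) = -1 := by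
      rw [one_div, Real.logb_inv, Real.logb_self_eq_one (by norm_num)]
    have hd : Real.logb 2 (1 / 128) = -7 := by
      rw [one_div, Real.logb_inv, show (128 : ℝ) = 2 ^ (7 : ℝ) by norm_num,
        Real.logb_rpow (by norm_num) (by norm_num)]
    have he : Real.logb 2 (1 / 128) ≤ Real.logb 2 (1 / 100) :=
      Real.logb_le_logb_of_le (by norm_num) (by norm_num) (by norm_num)
    have hf : Real.logb 2 (1 / 100 * ε ^ 4) = Real.logb 2 (1 / 100) + 4 * Real.logb 2 ε := by
      rw [Real.logb_mul (by norm_num) (by positivity), Real.logb_pow]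
      norm_num
    have hg : Real.logb 2 (1 / ε) = -Real.logb 2 ε := by rw [one_div, Real.logb_inv]
    have hi : Real.logb 2 ε ≤ 0 := Real.logb_nonpos (by norm_num) hε.le hε1.le
    rw [hm, hf, hg]
    linarith
  refine le_trans ?_ (EReal.coe_le_coe_iff.mpr hreal)
  push_cast
  exact EReal.sub_le_sub (EReal.sub_le_sub (EReal.sub_le_sub (EReal.sub_le_sub le_rfl hmle)
    le_rfl) le_rfl) le_rfl
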